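/- Let $\mathcal X,\mathcal Y,\mathcal Z,\widetilde{\mathcal Z},\mathfrak Z$ be finite-dimensional real Hilbert spaces. For such a space $\mathcal H$, let $\Gamma_0(\mathcal H)$ be the set of proper lower semicontinuous convex functions $\mathcal H\to(-\infty,\infty]$; call $g\in\Gamma_0(\mathcal H)$ coercive if $g(x)\to\infty$ as $\|x\|\to\infty$. Let $\mathbf C\subset\mathfrak Z$ be a closed convex set, let $\mathfrak C:\mathcal X\to\mathfrak Z$, $A:\mathcal X\to\mathcal Y$, $\mathfrak L:\mathcal X\to\mathcal Z$ and $B:\mathcal Z\to\widetilde{\mathcal Z}$ be linear, let $\mu>0$, let $f:\mathcal Y\to\mathbb R$ be convex and continuously differentiable, and let $\Psi\in\Gamma_0(\mathcal Z)$ be coercive. Assume that there is $x\in\mathfrak C^{-1}(\mathbf C)$ with $\Psi(\mathfrak Lx)<\infty$. Put $$\Psi_B(z)=\Psi(z)-\min_{v\in\mathcal Z}\Big[\Psi(v)+\tfrac12\|B(z-v)\|^2\Big],\qquad J(x)=f(Ax)+\mu\,\Psi_B(\mathfrak Lx).$$ Assume the overall convexity condition $(C_1)$: the function $x\mapsto f(Ax)-\frac{\mu}{2}\|B\mathfrak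 Lx\|^2$ belongs to $\Gamma_0(\mathcal X)$. Then $J$ has a minimizer over the constraint set $\mathfrak C^{-1}(\mathbf C)=\{x\in\mathcal X:\mathfrak Cx\in\mathbf C\}$ if at least one of the following holds: (i) $f$ is coercive, and $\mathfrak C^{-1}(\mathbf C)$ is asymptotically multipolyhedral, i.e. $\mathfrak C^{-1}(\mathbf C)=S+K$ (Minkowski sum) with a compact set $S\subset\mathcal X$ and a polyhedral cone $K\subset\mathcal X$ (a finite intersection of half-spaces $\{x:\langle a,x\rangle\le 0\}$); (ii) $\mathfrak C^{-1}(\mathbf C)$ is bounded; (iii) $f$ is coercive and $\operatorname{null}A\cap\operatorname{null}\mathfrak L=\{0\}$. -/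

import Mathlib

open scoped Pointwise

noncomputable section

namespace NRC

/-- The effective domain of an extended-real-valued function. -/
def effDom {H : Type*} (f : H → EReal) : Set H := {x | f x < ⊤}

/-- `f ∈ Γ₀(H)`: `f` maps into `(-∞, ∞]` and is proper, lower semicontinuous and convex. -/
structure Gamma0 {H : Type*} [NormedAddCommGroup H] [InnerProductSpace ℝ H]
    (f : H → EReal) : Prop where
  ne_bot : ∀ x, f x ≠ ⊥
  proper : (effDom f).Nonempty
  lsc : LowerSemicontinuous f
  convex : ∀ (x y : H) (α : ℝ), 0 < α → α < 1 →
    f (α • x + (1 - α) • y) ≤ (α : EReal) * f x + ((1 - α : ℝ) : EReal) * f y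

/-- Coercivity: `f x → ∞` as `‖x‖ → ∞`. -/
def Coercive {H : Type*} [NormedAddCommGroup H] (f : H → EReal) : Prop :=
  Filter.Tendsto f (Filter.comap (fun x : H => ‖x‖) Filter.atTop) (nhds ⊤)

/-- A polyhedral cone: the intersection of finitely many closed half-spaces whose boundary
hyperplanes pass through the origin. -/
def IsPolyhedralCone {H : Type*} [NormedAddCommGroup H] [InnerProductSpace ℝ H]
    (K : Set H) : Prop :=
  ∃ s : Finset H, K = {x | ∀ a ∈ s, inner ℝ a x ≤ 0}

/-- Asymptotically multipolyhedral: the Minkowski sum of a compact set and a polyhedral cone. -/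
def AsymptoticallyMultipolyhedral {H : Type*} [NormedAddCommGroup H] [InnerProductSpace ℝ H]
    (D : Set H) : Prop :=
  ∃ S K : Set H, IsCompact S ∧ IsPolyhedralCone K ∧ D = S + K

variable {X Y Z W : Type*}
  [NormedAddCommGroup X] [InnerProductSpace ℝ X]
  [NormedAddCommGroup Y] [InnerProductSpace ℝ Y]
  [NormedAddCommGroup Z] [InnerProductSpace ℝ Z]
  [NormedAddCommGroup W] [InnerProductSpace ℝ W]

/-- The generalized Moreau enhancement
`Ψ_B(z) = Ψ(z) - min_v [Ψ(v) + ½ ‖B (z - v)‖²]`. The minimum is written as an infimum in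
`[-∞, ∞]`; for `Ψ ∈ Γ₀` coercive on a finite-dimensional space it is attained and finite. -/
def gme (Ψ : Z → EReal) (B : Z →ₗ[ℝ] W) (z : Z) : EReal :=
  Ψ z - ⨅ v : Z, (Ψ v + ((1 / 2 * ‖B (z - v)‖ ^ 2 : ℝ) : EReal))

/-- The cost function `J = f ∘ A + μ Ψ_B ∘ 𝔏`. -/
def cost (f : Y → ℝ) (A : X →ₗ[ℝ] Y) (μ : ℝ) (Ψ : Z → EReal) (B : Z →ₗ[ℝ] W)
    (𝔏 : X →ₗ[ℝ] Z) (x : X) : EReal :=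
  (f (A x) : EReal) + (μ : EReal) * gme Ψ B (𝔏 x)

/-- The function `𝔡(x) = f (A x) - (μ / 2) ‖B 𝔏 x‖²`. -/
def dFun (f : Y → ℝ) (A : X →ₗ[ℝ] Y) (μ : ℝ) (B : Z →ₗ[ℝ] W)
    (𝔏 : X →ₗ[ℝ] Z) (x : X) : ℝ :=
  f (A x) - μ / 2 * ‖B (𝔏 x)‖ ^ 2

/-- The overall convexity condition: `𝔡 ∈ Γ₀(X)`. -/
def OverallConvexity (f : Y → ℝ) (A : X →ₗ[ℝ] Y) (μ : ℝ) (B : Z →ₗ[ℝ] W)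
    (𝔏 : X →ₗ[ℝ] Z) : Prop :=
  Gamma0 (fun x : X => ((dFun f A μ B 𝔏 x : ℝ) : EReal))

end NRC

end

/-! The cost `J` depends on `x` only through the pair `(A x, 𝔏 x)`, so it is constant along
`N = ker A ⊓ ker 𝔏`. It is lower semicontinuous, because the infimum subtracted in `Ψ_B` is a
finite infimum of continuous functions of `z`. For bounded constraint sets this is already enough.

When `f` is coercive, each sublevel set of `J` has bounded image under `x ↦ (A x, 𝔏 x)`. Indeed
`Ψ_B ≥ 0`, so `J ≤ c` bounds `f (A x)` and hence `A x`. Overall convexity restricted to `ker A`, where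
`f ∘ A` is constant, forces `B 𝔏` to vanish there; hence `B 𝔏 x` is controlled by `A x`
(`norm_le_of_ker_le`), and with it the envelope at `𝔏 x`. What remains of `J ≤ c` bounds
`Ψ (𝔏 x)`, so `𝔏 x` is bounded by coercivity of `Ψ` (`cost_sublevel_bounded`).

Modulo `N` the sublevel sets are therefore bounded, and if `D + N` is closed, `D` being the constraint
set, then `J` attains its minimum over a compact part of `D + N`; a minimizer is moved back into `D`
along `N` without changing `J` (`exists_isMinOn_of_isClosed_add_ker`). In case (iii) `N` is trivial. In
case (i) `D + N = S + (K + N)`, and `K + N` is again a polyhedral cone by Fourier–Motzkin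
elimination, applied to one spanning vector of `N` at a time
(`IsPolyhedralCone.add_submodule`). -/

open scoped Pointwise

namespace NRC

section Generalities

variable {E F G : Type*}
  [NormedAddCommGroup E] [InnerProductSpace ℝ E]
  [NormedAddCommGroup F] [NormedSpace ℝ F]
  [NormedAddCommGroup G] [NormedSpace ℝ G]

/-! ### Coercive functions -/

theorem Coercive.exists_norm_le {H : Type*} [NormedAddCommGroup H] {f : H → EReal} (hf : Coercive f) (c : ℝ) :
    ∃ R : ℝ, ∀ x, f x ≤ c → ‖x‖ ≤ R := by
  have h := EReal.tendsto_nhds_top_iff_real.1 hf c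
  rw [Filter.eventually_comap] at h
  obtain ⟨R, hR⟩ := Filter.eventually_atTop.1 h
  refine ⟨R, fun x hx => ?_⟩
  by_contra! hlt
  exact absurd (hR _ hlt.le x rfl) (not_lt.2 hx)

/-- A coercive function in `Γ₀` on a finite-dimensional space is bounded below, since it attains its
minimum. -/
theorem Gamma0.exists_lower_bound [FiniteDimensional ℝ E] {f : E → EReal}
    (hf : Gamma0 f) (hc : Coercive f) : ∃ b : ℝ, ∀ x, (b : EReal) ≤ f x := by
  obtain ⟨x₀, hx₀⟩ := hf.proper
  obtain ⟨R, hR⟩ := hc.exists_norm_le (f x₀).toReal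
  have hcoe : ((f x₀).toReal : EReal) = f x₀ := EReal.coe_toReal (ne_of_lt hx₀) (hf.ne_bot x₀)
  rw [hcoe] at hR
  have hmem : x₀ ∈ Metric.closedBall (0 : E) R := by simpa using hR x₀ le_rfl
  obtain ⟨y, -, hmin⟩ := (hf.lsc.lowerSemicontinuousOn _).exists_isMinOn
    ⟨x₀, hmem⟩ (isCompact_closedBall (0 : E) R)
  have hy : ∀ x, f y ≤ f x := by
    intro x
    rcases le_total (f x) (f x₀) with h | h
    · exact hmin (by simpa using hR x h)
    · exact (hmin hmem).trans h
  refine ⟨(f y).toReal, fun x => ?_⟩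
  rw [EReal.coe_toReal (ne_of_lt ((hy x₀).trans_lt hx₀)) (hf.ne_bot y)]
  exact hy x

/-! ### Linear maps modulo their kernels -/

/-- A linear map on a finite-dimensional space is bounded below modulo its kernel: every value has a
preimage of comparable norm. -/
theorem exists_preimage_norm_le [FiniteDimensional ℝ E] (T : E →ₗ[ℝ] F) :
    ∃ M : ℝ, 0 ≤ M ∧ ∀ x, ∃ y, T y = T x ∧ ‖y‖ ≤ M * ‖T x‖ := by
  obtain ⟨g, hg⟩ := T.rangeRestrict.exists_rightInverse_of_surjective T.range_rangeRestrict
  refine ⟨‖g.toContinuousLinearMap‖, g.toContinuousLinearMap.opNorm_nonneg, fun x => ⟨g (T.rangeRestrict x), ?_, ?_⟩⟩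
  · exact congrArg Subtype.val (LinearMap.congr_fun hg (T.rangeRestrict x))
  · exact g.toContinuousLinearMap.le_opNorm (T.rangeRestrict x)

theorem norm_le_of_ker_le [FiniteDimensional ℝ E] (T : E →ₗ[ℝ] F) (U : E →ₗ[ℝ] G)
    (h : LinearMap.ker T ≤ LinearMap.ker U) : ∃ M : ℝ, 0 ≤ M ∧ ∀ x, ‖U x‖ ≤ M * ‖T x‖ := by
  obtain ⟨M, hM, hT⟩ := exists_preimage_norm_le T
  refine ⟨‖U.toContinuousLinearMap‖ * M, by positivity, fun x => ?_⟩
  obtain ⟨y, hy, hle⟩ := hT x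
  have hxy : U x = U y := by
    have : x - y ∈ LinearMap.ker U := h (by simp [hy])
    simpa [sub_eq_zero] using this
  calc ‖U x‖ = ‖U.toContinuousLinearMap y‖ := by rw [hxy]; rfl
    _ ≤ ‖U.toContinuousLinearMap‖ * ‖y‖ := U.toContinuousLinearMap.le_opNorm y
    _ ≤ ‖U.toContinuousLinearMap‖ * (M * ‖T x‖) := by gcongr
    _ = _ := by ring

/-- A lower semicontinuous function that factors through a linear map `T`, with a sublevel set whose
image under `T` is bounded, attains its minimum over `D` as soon as `D + ker T` is closed. -/
theorem exists_isMinOn_of_isClosed_add_ker [FiniteDimensional ℝ E] (T : E →ₗ[ℝ] F) {J : E → EReal}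
    (hJ : LowerSemicontinuous J) (hT : ∀ x y, T x = T y → J x = J y)
    {D : Set E} (hD : IsClosed (D + (LinearMap.ker T : Set E))) {x₀ : E} (hx₀ : x₀ ∈ D)
    {R : ℝ} (hR : ∀ x, J x ≤ J x₀ → ‖T x‖ ≤ R) : ∃ x ∈ D, IsMinOn J D x := by
  obtain ⟨M, hM, hpre⟩ := exists_preimage_norm_le T
  set P : Set E := Metric.closedBall 0 (M * R) ∩ (D + (LinearMap.ker T : Set E))
  have key : ∀ x ∈ D, J x ≤ J x₀ → ∃ y ∈ P, J y = J x := by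
    intro x hx hle
    obtain ⟨y, hy, hn⟩ := hpre x
    refine ⟨y, ⟨?_, x, hx, y - x, by simp [hy], by simp⟩, hT _ _ hy⟩
    rw [mem_closedBall_zero_iff]
    exact hn.trans (mul_le_mul_of_nonneg_left (hR x hle) hM)
  obtain ⟨y₀, hy₀, hJy₀⟩ := key x₀ hx₀ le_rfl
  obtain ⟨y, ⟨-, d, hd, n, hn, rfl⟩, hmin⟩ := (hJ.lowerSemicontinuousOn P).exists_isMinOn
    ⟨y₀, hy₀⟩ ((isCompact_closedBall 0 (M * R)).inter_right hD)
  have hdn : J (d + n) = J d := hT _ _ (by simpa using hn)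
  refine ⟨d, hd, fun x hx => ?_⟩
  change J d ≤ J x
  rw [← hdn]
  rcases le_total (J x) (J x₀) with h | h
  · obtain ⟨z, hz, hJz⟩ := key x hx h
    exact hJz ▸ hmin hz
  · exact (hJy₀ ▸ hmin hy₀ : J (d + n) ≤ J x₀).trans h

/-! ### Polyhedral cones -/

theorem IsPolyhedralCone.isClosed {K : Set E} (hK : IsPolyhedralCone K) : IsClosed K := by
  obtain ⟨s, rfl⟩ := hK
  simp only [Set.ofPred_forall]
  exact isClosed_biInter fun a _ => isClosed_le (by fun_prop) continuous_const

/-- Finitely many inequalities `p i + t * q i ≤ 0` in one real unknown are solvable once every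
pair of them with coefficients of opposite sign is compatible. -/
theorem exists_forall_add_mul_nonpos {ι : Type*} (s : Finset ι) (p q : ι → ℝ)
    (h0 : ∀ i ∈ s, q i = 0 → p i ≤ 0)
    (h1 : ∀ i ∈ s, ∀ j ∈ s, 0 < q i → q j < 0 → q i * p j - q j * p i ≤ 0) :
    ∃ t : ℝ, ∀ i ∈ s, p i + t * q i ≤ 0 := by
  classical
  let lo : Set ℝ := (fun i => -p i / q i) '' {i | i ∈ s ∧ q i < 0}
  let hi : Set ℝ := (fun i => -p i / q i) '' {i | i ∈ s ∧ 0 < q i}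
  have hlo : lo.Finite := (s.finite_toSet.subset fun i hi => hi.1).image _
  have hhi : hi.Finite := (s.finite_toSet.subset fun i hi => hi.1).image _
  have hle : ∀ a ∈ lo, ∀ b ∈ hi, a ≤ b := by
    rintro _ ⟨j, ⟨hj, hqj⟩, rfl⟩ _ ⟨i, ⟨hi', hqi⟩, rfl⟩
    have := h1 i hi' j hj hqi hqj
    change -p j / q j ≤ -p i / q i
    rw [div_le_iff_of_neg hqj, div_mul_eq_mul_div, div_le_iff₀ hqi]
    linarith
  obtain ⟨t, htlo, hthi⟩ : ∃ t, t ∈ upperBounds lo ∧ t ∈ lowerBounds hi := by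
    rcases lo.eq_empty_or_nonempty with he | hne
    · obtain ⟨t, ht⟩ := hhi.bddBelow
      exact ⟨t, by simp [he], ht⟩
    rcases hi.eq_empty_or_nonempty with he' | hne'
    · obtain ⟨t, ht⟩ := hlo.bddAbove
      exact ⟨t, ht, by simp [he']⟩
    exact exists_between_of_forall_le hne hne' hle
  refine ⟨t, fun i hi' => ?_⟩
  rcases lt_trichotomy (q i) 0 with hq | hq | hq
  · have := htlo ⟨i, ⟨hi', hq⟩, rfl⟩
    change -p i / q i ≤ t at this
    rw [div_le_iff_of_neg hq] at this
    linarith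
  · simpa [hq] using h0 i hi' hq
  · have := hthi ⟨i, ⟨hi', hq⟩, rfl⟩
    change t ≤ -p i / q i at this
    rw [le_div_iff₀ hq] at this
    linarith

/-- Fourier–Motzkin elimination of the direction `n`. -/
theorem IsPolyhedralCone.add_span_singleton {K : Set E} (hK : IsPolyhedralCone K) (n : E) :
    IsPolyhedralCone (K + (Submodule.span ℝ {n} : Set E)) := by
  classical
  obtain ⟨s, rfl⟩ := hK
  refine ⟨s.filter (fun a => inner ℝ a n = 0) ∪
    ((s.filter (fun a => 0 < inner ℝ a n)) ×ˢ (s.filter (fun b => inner ℝ b n < 0))).image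
      (fun ab => inner ℝ ab.1 n • ab.2 - inner ℝ ab.2 n • ab.1), ?_⟩
  ext x
  constructor
  · rintro ⟨k, hk, m, hm, rfl⟩ a ha
    obtain ⟨t, rfl⟩ := Submodule.mem_span_singleton.1 hm
    rw [Finset.mem_union, Finset.mem_filter, Finset.mem_image] at ha
    rcases ha with ⟨has, han⟩ | ⟨⟨u, v⟩, huv, rfl⟩
    · simpa [inner_add_right, inner_smul_right, han] using hk a has
    · simp only [Finset.mem_product, Finset.mem_filter] at huv
      obtain ⟨⟨hus, hun⟩, hvs, hvn⟩ := huv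
      have h1 := mul_nonpos_of_nonneg_of_nonpos hun.le (hk v hvs)
      have h2 := mul_nonneg_of_nonpos_of_nonpos hvn.le (hk u hus)
      simp only [inner_add_right, inner_smul_right, inner_sub_left, real_inner_smul_left]
      linarith
  · intro hx
    obtain ⟨t, ht⟩ := exists_forall_add_mul_nonpos s (fun a => inner ℝ a x)
      (fun a => inner ℝ a n)
      (fun a ha h0 => hx a (by simp [ha, h0]))
      (fun a ha b hb hpos hneg => by
        have := hx (inner ℝ a n • b - inner ℝ b n • a) (Finset.mem_union_right _
          (Finset.mem_image.2 ⟨(a, b), by simp [ha, hb, hpos, hneg], rfl⟩))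
        simpa [inner_sub_left, real_inner_smul_left] using this)
    refine ⟨x + t • n, fun a ha => ?_, -(t • n), ?_, by simp⟩
    · simpa [inner_add_right, inner_smul_right] using ht a ha
    · exact neg_mem (Submodule.smul_mem _ _ (Submodule.mem_span_singleton_self n))

theorem IsPolyhedralCone.add_submodule [FiniteDimensional ℝ E] {K : Set E}
    (hK : IsPolyhedralCone K) (N : Submodule ℝ E) : IsPolyhedralCone (K + (N : Set E)) := by
  refine Submodule.fg_induction
    (motive := fun N _ => ∀ K : Set E, IsPolyhedralCone K → IsPolyhedralCone (K + (N : Set E)))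
    (fun x K hK => hK.add_span_singleton x) (fun N₁ N₂ _ _ h₁ h₂ K hK => ?_)
    N (IsNoetherian.noetherian N) K hK
  rw [Submodule.coe_sup, ← add_assoc]
  exact h₂ _ (h₁ _ hK)

theorem AsymptoticallyMultipolyhedral.isClosed_add_submodule [FiniteDimensional ℝ E] {D : Set E}
    (hD : AsymptoticallyMultipolyhedral D) (N : Submodule ℝ E) : IsClosed (D + (N : Set E)) := by
  obtain ⟨S, K, hS, hK, rfl⟩ := hD
  rw [add_assoc]
  exact (hK.add_submodule N).isClosed.add_left_of_isCompact hS

end Generalities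

variable {X Y Z W : Type*}
  [NormedAddCommGroup X] [InnerProductSpace ℝ X]
  [NormedAddCommGroup Y] [InnerProductSpace ℝ Y]
  [NormedAddCommGroup Z] [InnerProductSpace ℝ Z]
  [NormedAddCommGroup W] [InnerProductSpace ℝ W]

/-! ### The generalized Moreau envelope -/

/-- The generalized Moreau envelope `z ↦ inf_v [Ψ(v) + ½ ‖B (z - v)‖²]`, the function that `gme`
subtracts from `Ψ`. -/
noncomputable def envelope (Ψ : Z → EReal) (B : Z →ₗ[ℝ] W) (z : Z) : EReal :=
  ⨅ v : Z, (Ψ v + ((1 / 2 * ‖B (z - v)‖ ^ 2 : ℝ) : EReal))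

theorem envelope_le_self (Ψ : Z → EReal) (B : Z →ₗ[ℝ] W) (z : Z) : envelope Ψ B z ≤ Ψ z :=
  (iInf_le _ z).trans (by simp)

theorem envelope_ne_bot [FiniteDimensional ℝ Z]
    {Ψ : Z → EReal} (hΨ : Gamma0 Ψ) (hc : Coercive Ψ) (B : Z →ₗ[ℝ] W) (z : Z) :
    envelope Ψ B z ≠ ⊥ := by
  obtain ⟨b, hb⟩ := hΨ.exists_lower_bound hc
  refine ne_bot_of_le_ne_bot (EReal.coe_ne_bot b) (le_iInf fun v => ?_)
  have : (0 : EReal) ≤ ((1 / 2 * ‖B (z - v)‖ ^ 2 : ℝ) : EReal) :=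
    EReal.coe_nonneg.2 (by positivity)
  simpa using add_le_add (hb v) this

theorem exists_envelope_le {Ψ : Z → EReal} (hΨ : Gamma0 Ψ) (B : Z →ₗ[ℝ] W) :
    ∃ c : ℝ, ∀ z, envelope Ψ B z ≤ ((c + ‖B z‖ ^ 2 : ℝ) : EReal) := by
  obtain ⟨v, hv⟩ := hΨ.proper
  refine ⟨(Ψ v).toReal + ‖B v‖ ^ 2, fun z => (iInf_le _ v).trans ?_⟩
  rw [← EReal.coe_toReal (ne_of_lt hv) (hΨ.ne_bot v), ← EReal.coe_add, EReal.coe_le_coe_iff,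
    EReal.toReal_coe, map_sub]
  have h := norm_sub_le (B z) (B v)
  have h0 := norm_nonneg (B z - B v)
  nlinarith [sq_nonneg (‖B z‖ - ‖B v‖)]

theorem envelope_ne_top {Ψ : Z → EReal} (hΨ : Gamma0 Ψ) (B : Z →ₗ[ℝ] W) (z : Z) :
    envelope Ψ B z ≠ ⊤ := by
  obtain ⟨c, hc⟩ := exists_envelope_le hΨ B
  exact ne_top_of_le_ne_top (EReal.coe_ne_top _) (hc z)

theorem upperSemicontinuous_envelope [FiniteDimensional ℝ Z]
    (Ψ : Z → EReal) (B : Z →ₗ[ℝ] W) :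
    UpperSemicontinuous (envelope Ψ B) := by
  refine upperSemicontinuous_iInf fun v => Continuous.upperSemicontinuous ?_
  have hB : Continuous B := B.continuous_of_finiteDimensional
  have hr : Continuous fun z => ((1 / 2 * ‖B (z - v)‖ ^ 2 : ℝ) : EReal) :=
    continuous_coe_real_ereal.comp (by fun_prop)
  rw [continuous_iff_continuousAt]
  intro z
  exact ContinuousAt.comp (f := fun z => (Ψ v, ((1 / 2 * ‖B (z - v)‖ ^ 2 : ℝ) : EReal)))
    (EReal.continuousAt_add (Or.inr (EReal.coe_ne_bot _)) (Or.inr (EReal.coe_ne_top _)))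
    (continuous_const.prodMk hr).continuousAt

theorem lowerSemicontinuous_gme [FiniteDimensional ℝ Z]
    {Ψ : Z → EReal} (hΨ : Gamma0 Ψ) (hc : Coercive Ψ)
    (B : Z →ₗ[ℝ] W) : LowerSemicontinuous (gme Ψ B) := by
  have h : LowerSemicontinuous fun z => -envelope Ψ B z :=
    continuous_neg.comp_upperSemicontinuous_antitone (upperSemicontinuous_envelope Ψ B)
      fun _ _ hab => EReal.neg_le_neg_iff.2 hab
  exact hΨ.lsc.add' h fun z => EReal.continuousAt_add
    (Or.inr (mt EReal.neg_eq_bot_iff.1 (envelope_ne_top hΨ B z)))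
    (Or.inr (mt EReal.neg_eq_top_iff.1 (envelope_ne_bot hΨ hc B z)))

theorem gme_nonneg [FiniteDimensional ℝ Z]
    {Ψ : Z → EReal} (hΨ : Gamma0 Ψ) (hc : Coercive Ψ) (B : Z →ₗ[ℝ] W) (z : Z) :
    0 ≤ gme Ψ B z :=
  (EReal.sub_nonneg (Or.inr (envelope_ne_top hΨ B z)) (Or.inr (envelope_ne_bot hΨ hc B z))).2
    (envelope_le_self Ψ B z)

/-! ### The cost function -/

theorem lowerSemicontinuous_cost [FiniteDimensional ℝ X] [FiniteDimensional ℝ Z]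
    {f : Y → ℝ} (hf : Continuous f) (A : X →ₗ[ℝ] Y)
    {μ : ℝ} (hμ : 0 < μ) {Ψ : Z → EReal} (hΨ : Gamma0 Ψ) (hc : Coercive Ψ)
    (B : Z →ₗ[ℝ] W) (𝔏 : X →ₗ[ℝ] Z) : LowerSemicontinuous (cost f A μ Ψ B 𝔏) := by
  have hA : Continuous A := A.continuous_of_finiteDimensional
  have h1 : Continuous fun x => (f (A x) : EReal) := continuous_coe_real_ereal.comp (hf.comp hA)
  have hμ0 : (μ : EReal) ≠ 0 := EReal.coe_ne_zero.2 hμ.ne'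
  have hmul : Continuous fun a : EReal => (μ : EReal) * a :=
    continuous_iff_continuousAt.2 fun a => ContinuousAt.comp (f := fun a => ((μ : EReal), a))
      (EReal.continuousAt_mul (Or.inl hμ0) (Or.inl hμ0) (Or.inl (EReal.coe_ne_bot μ))
        (Or.inl (EReal.coe_ne_top μ))) (continuous_const.prodMk continuous_id).continuousAt
  have h2 : LowerSemicontinuous fun x => (μ : EReal) * gme Ψ B (𝔏 x) :=
    hmul.comp_lowerSemicontinuous
      ((lowerSemicontinuous_gme hΨ hc B).comp 𝔏.continuous_of_finiteDimensional)
      fun _ _ hab => mul_le_mul_of_nonneg_left hab (EReal.coe_nonneg.2 hμ.le)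
  exact h1.lowerSemicontinuous.add' h2 fun x => EReal.continuousAt_add
    (Or.inl (EReal.coe_ne_top _)) (Or.inl (EReal.coe_ne_bot _))

/-- Along `ker A` the function `f ∘ A` is constant, so convexity of `f ∘ A - (μ/2) ‖B 𝔏 ·‖²` makes the
quadratic term vanish there. -/
theorem OverallConvexity.ker_le {f : Y → ℝ} {A : X →ₗ[ℝ] Y} {μ : ℝ} (hμ : 0 < μ)
    {B : Z →ₗ[ℝ] W} {𝔏 : X →ₗ[ℝ] Z} (h : OverallConvexity f A μ B 𝔏) :
    LinearMap.ker A ≤ LinearMap.ker (B ∘ₗ 𝔏) := by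
  intro w hw
  have hA : A w = 0 := hw
  -- midpoint convexity at `0 = ½ w + ½ (-w)`
  have hmid := h.convex w (-w) (1 / 2) (by norm_num) (by norm_num)
  rw [← EReal.coe_mul, ← EReal.coe_mul, ← EReal.coe_add, EReal.coe_le_coe_iff] at hmid
  have h0 : (1 / 2 : ℝ) • w + (1 - 1 / 2 : ℝ) • -w = 0 := by
    rw [smul_neg]; norm_num
  rw [h0] at hmid
  simp only [dFun, map_zero, map_neg, norm_neg, norm_zero, hA, neg_zero] at hmid
  have hsq : μ * ‖B (𝔏 w)‖ ^ 2 ≤ 0 := by linarith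
  have : ‖B (𝔏 w)‖ ^ 2 ≤ 0 := by
    by_contra! hpos
    exact absurd (mul_pos hμ hpos) (not_lt.2 hsq)
  have hz : B (𝔏 w) = 0 := by
    rw [← norm_eq_zero]
    exact pow_eq_zero_iff (two_ne_zero) |>.1 (le_antisymm this (sq_nonneg _))
  simpa using hz

theorem cost_sublevel_bounded [FiniteDimensional ℝ X] [FiniteDimensional ℝ Y] [FiniteDimensional ℝ Z]
    {f : Y → ℝ} {A : X →ₗ[ℝ] Y} {μ : ℝ} (hμ : 0 < μ)
    {Ψ : Z → EReal} {B : Z →ₗ[ℝ] W} {𝔏 : X →ₗ[ℝ] Z}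
    (hf : Gamma0 (fun y : Y => (f y : EReal))) (hfc : Coercive (fun y : Y => (f y : EReal)))
    (hΨ : Gamma0 Ψ) (hΨc : Coercive Ψ) (h : OverallConvexity f A μ B 𝔏) (c : ℝ) :
    ∃ R : ℝ, ∀ x, cost f A μ Ψ B 𝔏 x ≤ c → ‖A.prod 𝔏 x‖ ≤ R := by
  obtain ⟨M, hM, hBL⟩ := norm_le_of_ker_le A (B ∘ₗ 𝔏) (h.ker_le hμ)
  obtain ⟨b, hb⟩ := hf.exists_lower_bound hfc
  obtain ⟨e, he⟩ := exists_envelope_le hΨ B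
  obtain ⟨R₁, hR₁⟩ := hfc.exists_norm_le c
  obtain ⟨R₂, hR₂⟩ := hΨc.exists_norm_le ((c - b) / μ + (e + (M * R₁) ^ 2))
  refine ⟨max R₁ R₂, fun x hx => ?_⟩
  have hg : 0 ≤ gme Ψ B (𝔏 x) := gme_nonneg hΨ hΨc B _
  have hA : ‖A x‖ ≤ R₁ := by
    refine hR₁ _ (le_trans ?_ hx)
    simpa [cost] using add_le_add_right
      (EReal.mul_nonneg (EReal.coe_nonneg.2 hμ.le) hg) (f (A x) : EReal)
  have hB : ‖B (𝔏 x)‖ ≤ M * R₁ := (hBL x).trans (mul_le_mul_of_nonneg_left hA hM)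
  have henv : envelope Ψ B (𝔏 x) ≤ ((e + (M * R₁) ^ 2 : ℝ) : EReal) :=
    (he _).trans (EReal.coe_le_coe_iff.2 (by gcongr))
  have hgtop : gme Ψ B (𝔏 x) ≠ ⊤ := by
    intro ht
    simp [cost, ht, EReal.coe_mul_top_of_pos hμ] at hx
  have hgle : gme Ψ B (𝔏 x) ≤ (((c - b) / μ : ℝ) : EReal) := by
    have hcoe := EReal.coe_toReal hgtop (ne_bot_of_le_ne_bot EReal.zero_ne_bot hg)
    have hbA := hb (A x)
    rw [cost, ← hcoe, ← EReal.coe_mul, ← EReal.coe_add, EReal.coe_le_coe_iff] at hx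
    rw [EReal.coe_le_coe_iff] at hbA
    rw [← hcoe, EReal.coe_le_coe_iff, le_div_iff₀ hμ]
    linarith
  have hΨle : Ψ (𝔏 x) ≤ (((c - b) / μ + (e + (M * R₁) ^ 2) : ℝ) : EReal) := by
    have h1 : Ψ (𝔏 x) ≤ (((c - b) / μ : ℝ) : EReal) + envelope Ψ B (𝔏 x) :=
      (EReal.sub_le_iff_le_add (Or.inl (envelope_ne_bot hΨ hΨc B _))
        (Or.inl (envelope_ne_top hΨ B _))).1 hgle
    rw [EReal.coe_add ((c - b) / μ)]
    exact h1.trans (add_le_add_right henv _)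
  exact max_le_max hA (hR₂ _ hΨle)

/-- Coercive case, with the dependence on the constraint set reduced to closedness of its sum with
`ker A ⊓ ker 𝔏`. -/
theorem exists_isMinOn_cost [FiniteDimensional ℝ X] [FiniteDimensional ℝ Y] [FiniteDimensional ℝ Z]
    {f : Y → ℝ} {A : X →ₗ[ℝ] Y} {μ : ℝ} (hμ : 0 < μ)
    {Ψ : Z → EReal} {B : Z →ₗ[ℝ] W} {𝔏 : X →ₗ[ℝ] Z} (hfcont : Continuous f)
    (hf : Gamma0 (fun y : Y => (f y : EReal))) (hfc : Coercive (fun y : Y => (f y : EReal)))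
    (hΨ : Gamma0 Ψ) (hΨc : Coercive Ψ) (h : OverallConvexity f A μ B 𝔏) {D : Set X}
    (hdom : (effDom (fun x : X => Ψ (𝔏 x)) ∩ D).Nonempty)
    (hD : IsClosed (D + ((LinearMap.ker A ⊓ LinearMap.ker 𝔏 : Submodule ℝ X) : Set X))) :
    ∃ x ∈ D, IsMinOn (cost f A μ Ψ B 𝔏) D x := by
  obtain ⟨x₀, hx₀, hx₀D⟩ := hdom
  have hfin : ∃ c : ℝ, cost f A μ Ψ B 𝔏 x₀ = c := by
    refine ⟨f (A x₀) + μ * ((Ψ (𝔏 x₀)).toReal - (envelope Ψ B (𝔏 x₀)).toReal), ?_⟩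
    rw [EReal.coe_add, EReal.coe_mul, EReal.coe_sub,
      EReal.coe_toReal (ne_of_lt hx₀) (hΨ.ne_bot _),
      EReal.coe_toReal (envelope_ne_top hΨ B _) (envelope_ne_bot hΨ hΨc B _)]
    rfl
  obtain ⟨c, hc⟩ := hfin
  obtain ⟨R, hR⟩ := cost_sublevel_bounded hμ hf hfc hΨ hΨc h c
  rw [← LinearMap.ker_prod] at hD
  refine exists_isMinOn_of_isClosed_add_ker (A.prod 𝔏)
    (lowerSemicontinuous_cost hfcont A hμ hΨ hΨc B 𝔏) (fun x y hxy => ?_) hD hx₀D (hc ▸ hR)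
  obtain ⟨h1, h2⟩ : A x = A y ∧ 𝔏 x = 𝔏 y := by simpa using hxy
  rw [cost, cost, h1, h2]

end NRC

theorem theorem1
    {X Y Z W V : Type*}
    [NormedAddCommGroup X] [InnerProductSpace ℝ X] [FiniteDimensional ℝ X]
    [NormedAddCommGroup Y] [InnerProductSpace ℝ Y] [FiniteDimensional ℝ Y]
    [NormedAddCommGroup Z] [InnerProductSpace ℝ Z] [FiniteDimensional ℝ Z]
    [NormedAddCommGroup W] [InnerProductSpace ℝ W] [FiniteDimensional ℝ W]
    [NormedAddCommGroup V] [InnerProductSpace ℝ V] [FiniteDimensional ℝ V]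
    (C : Set V) (hC_closed : IsClosed C) (hC_convex : Convex ℝ C) (ℭ : X →ₗ[ℝ] V)
    (A : X →ₗ[ℝ] Y) (f : Y → ℝ)
    (hf : NRC.Gamma0 (fun y : Y => (f y : EReal))) (hf_diff : ContDiff ℝ 1 f)
    (μ : ℝ) (hμ : 0 < μ) (𝔏 : X →ₗ[ℝ] Z) (B : Z →ₗ[ℝ] W)
    (Ψ : Z → EReal) (hΨ : NRC.Gamma0 Ψ) (hΨ_coercive : NRC.Coercive Ψ)
    (h_dom : (NRC.effDom (fun x : X => Ψ (𝔏 x)) ∩ ℭ ⁻¹' C).Nonempty)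
    (hC₁ : NRC.OverallConvexity f A μ B 𝔏)
    (h : (NRC.Coercive (fun y : Y => (f y : EReal)) ∧
            NRC.AsymptoticallyMultipolyhedral (ℭ ⁻¹' C)) ∨
          Bornology.IsBounded (ℭ ⁻¹' C) ∨
          (NRC.Coercive (fun y : Y => (f y : EReal)) ∧
            LinearMap.ker A ⊓ LinearMap.ker 𝔏 = ⊥)) :
    ∃ x ∈ ℭ ⁻¹' C, IsMinOn (NRC.cost f A μ Ψ B 𝔏) (ℭ ⁻¹' C) x := by
  have hD : IsClosed (ℭ ⁻¹' C) := hC_closed.preimage ℭ.continuous_of_finiteDimensional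
  have hfcont : Continuous f := hf_diff.continuous
  rcases h with ⟨hfc, hM⟩ | hbdd | ⟨hfc, hker⟩
  · exact NRC.exists_isMinOn_cost hμ hfcont hf hfc hΨ hΨ_coercive hC₁ h_dom
      (hM.isClosed_add_submodule _)
  · exact ((NRC.lowerSemicontinuous_cost hfcont A hμ hΨ hΨ_coercive B 𝔏).lowerSemicontinuousOn
      _).exists_isMinOn (h_dom.mono Set.inter_subset_right)
      (Metric.isCompact_of_isClosed_isBounded hD hbdd)
  · refine NRC.exists_isMinOn_cost hμ hfcont hf hfc hΨ hΨ_coercive hC₁ h_dom ?_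
    simpa [hker] using hD
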